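/- **Theorem 1.6 (Averaging effects for antisymmetric functions).** Let $n\ge 1$ and $0<s<1$. For $\lambda\in\mathbb R$ put $T_\lambda=\{x\in\mathbb R^n: x_n=\lambda\}$, $\Sigma_\lambda=\{x\in\mathbb R^n: x_n<\lambda\}$ and $x^\lambda=(x_1,\dots,x_{n-1},2\lambda-x_n)$. Let $$(-\Delta)^s w(x)=C_{n,s}\,\mathrm{PV}\!\int_{\mathbb R^n}\frac{w(x)-w(y)}{|x-y|^{n+2s}}\,dy,\qquad C_{n,s}=\frac{4^s\,\Gamma(\frac n2+s)}{\pi^{n/2}\,|\Gamma(-s)|},$$ and let $\mathcal L_{2s}$ be the set of $w\in L^1_{loc}(\mathbb R^n)$ with $\int_{\mathbb R^n}\frac{|w(x)|}{1+|x|^{n+2s}}\,dx<\infty$. For a bounded domain (non-empty, open, connected) $\tilde D\subset\Sigma_\lambda$ and $R>0$ define $$\tilde D_R=\Big\{x\in\mathbb R^n\setminus\tilde D:\ \mathrm{dist}(x,\tilde D)\le R,\ \ x_n\le\lambda-\tfrac12\,\mathrm{dist}(\tilde D,T_\lambda)\Big\}.$$ Assume that $w\in C^{1,1}_{loc}(\mathbb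 R^n)\cap\mathcal L_{2s}$ is uniformly continuous and satisfies $$(-\Delta)^s w(x)=c(x)w(x),\qquad w(x)=-w(x^\lambda),\qquad w(x)\ge 0\qquad\text{for all }x\in\Sigma_\lambda,$$ where $c$ is bounded from below on $\Sigma_\lambda$. If $w\ge\tilde C_0$ on $\tilde D$ for a constant $\tilde C_0>0$, then there is a constant $\tilde\delta_0>0$ such that $$w(x)\ge\tilde\delta_0\qquad\text{for all }x\in\tilde D_R.$$ The constant $\tilde\delta_0$ depends only on $R$ and $\tilde C_0$, on $n$ and $s$, on a lower bound $-K$ of $c$ on $\Sigma_\lambda$, and on a modulus of uniform continuity of $w$ (a function $\eta:(0,\infty)\to(0,\infty)$ such that $|x-y|<\eta(\varepsilon)$ implies $|w(x)-w(y)|<\varepsilon$). In particular, it is independent of $\lambda$ and of the set $\tilde D$ (its location, size and shape). -/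

import Mathlib

open Set Filter Topology MeasureTheory

noncomputable section

/-- The Euclidean space `ℝⁿ` of dimension `n = d + 1 ≥ 1`. -/
abbrev Space (d : ℕ) : Type := EuclideanSpace ℝ (Fin (d + 1))

/-- The last coordinate `xₙ` of a point. -/
def lastCoord {d : ℕ} (x : Space d) : ℝ := x (Fin.last d)

/-- The hyperplane `T_l = {xₙ = l}`. -/
def hyperplaneT (d : ℕ) (l : ℝ) : Set (Space d) := {x | lastCoord x = l}

/-- The open half space `Σ_l = {xₙ < l}` below `T_l`. -/
def halfSpaceBelow (d : ℕ) (l : ℝ) : Set (Space d) := {x | lastCoord x < l}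

/-- The reflection `x^l = (x', 2 l - xₙ)` of `x` across `T_l`. -/
def reflectT {d : ℕ} (l : ℝ) (x : Space d) : Space d :=
  WithLp.toLp 2 (Function.update (fun i => x i) (Fin.last d) (2 * l - lastCoord x))

/-- The distance between two sets: the infimum of the distances between their points. -/
def setDist {d : ℕ} (A B : Set (Space d)) : ℝ :=
  sInf {r : ℝ | ∃ a ∈ A, ∃ b ∈ B, r = dist a b}

/-- The set `D_R` of the points outside `D`, within distance `R` of `D`, lying at least
`dist(D, T_l) / 2` below `T_l`. -/
def enlargement {d : ℕ} (l R : ℝ) (D : Set (Space d)) : Set (Space d) :=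
  {x | x ∉ D ∧ Metric.infDist x D ≤ R ∧ lastCoord x ≤ l - setDist D (hyperplaneT d l) / 2}

/-- The normalization constant
`C_{n,s} = 4^s Γ(n/2 + s) / (π^{n/2} |Γ(-s)|)` of the fractional Laplacian. -/
def fracLapConst (n : ℕ) (s : ℝ) : ℝ :=
  (4 : ℝ) ^ s * Real.Gamma ((n : ℝ) / 2 + s) /
    (Real.pi ^ ((n : ℝ) / 2) * |Real.Gamma (-s)|)

/-- `HasFracLaplacian s w x v`: the principal value integral defining `(-Δ)^s w (x)`
exists and equals `v`, that is, the integrals over `{|y - x| ≥ ε}` converge absolutely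
and, multiplied by `C_{n,s}`, tend to `v` as `ε → 0+`. -/
def HasFracLaplacian {d : ℕ} (s : ℝ) (w : Space d → ℝ) (x : Space d) (v : ℝ) : Prop :=
  (∀ ε : ℝ, 0 < ε →
    IntegrableOn (fun y => (w x - w y) / ‖x - y‖ ^ (((d + 1 : ℕ) : ℝ) + 2 * s))
      (Metric.ball x ε)ᶜ volume) ∧
  Tendsto
    (fun ε : ℝ => fracLapConst (d + 1) s *
      ∫ y in (Metric.ball x ε)ᶜ, (w x - w y) / ‖x - y‖ ^ (((d + 1 : ℕ) : ℝ) + 2 * s))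
    (𝓝[>] 0) (𝓝 v)

/-- The space `L_{2s}` of locally integrable `w` with
`∫ |w(x)| / (1 + |x|^{n+2s}) dx < ∞`. -/
def MemL2s {d : ℕ} (s : ℝ) (w : Space d → ℝ) : Prop :=
  LocallyIntegrable w volume ∧
  Integrable (fun x => |w x| / (1 + ‖x‖ ^ (((d + 1 : ℕ) : ℝ) + 2 * s))) volume

/-- `C^{1,1}_loc(ℝⁿ)`: continuously differentiable with locally Lipschitz derivative. -/
def IsC11Loc {d : ℕ} (w : Space d → ℝ) : Prop :=
  ContDiff ℝ 1 w ∧ LocallyLipschitz (fderiv ℝ w)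

/-- `η : (0, ∞) → (0, ∞)` is a modulus of uniform continuity of `w`:
`|x - y| < η(ε)` implies `|w(x) - w(y)| < ε`. -/
def HasModulus {d : ℕ} (η : ℝ → ℝ) (w : Space d → ℝ) : Prop :=
  ∀ ε : ℝ, 0 < ε → ∀ x y : Space d, dist x y < η ε → |w x - w y| < ε

/-- The uniformly continuous functions are exactly those with some modulus. -/
theorem uniformContinuous_iff_exists_hasModulus {d : ℕ} (w : Space d → ℝ) :
    UniformContinuous w ↔ ∃ η : ℝ → ℝ, (∀ ε : ℝ, 0 < ε → 0 < η ε) ∧ HasModulus η w := by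
  rw [Metric.uniformContinuous_iff]
  constructor
  · intro h
    choose! η h1 h2 using h
    exact ⟨η, h1, fun ε hε x y hxy => h2 ε hε hxy⟩
  · rintro ⟨η, h1, h2⟩ ε hε
    exact ⟨η ε, h1 ε hε, fun {x y} hxy => h2 ε hε x y hxy⟩

end

/-! Argue by contradiction from a point `x₀` of the enlargement with `w x₀ < δ`. Antisymmetry and
the modulus keep `D`, hence also `x₀`, at a definite distance from the hyperplane
(`half_modulus_le_of_antisymm`), and `w` stays above `C₀ / 2` on a ball `G` of definite radius
around a point of `D` near `x₀`.

The equation cannot be tested at `x₀`, since no second-order bound on `w` is at hand that is uniform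
in `w`. Touching `w` from below by a paraboloid of opening of order `δ` moves the test to a nearby
point `x` with `w x < δ` (`exists_quadratic_touching_point`). There the singular part of the
integral is `O(δ)`, the linear term being odd (`setIntegral_annulus_le_of_quadratic_bound`).

Folding the rest of the integral onto the half space pairs each `y` with its reflection. As the
kernel is larger at `y`, the ball `G` contributes a fixed negative amount
(`setIntegral_compl_ball_le_of_antisymm`). So the fractional Laplacian at `x` is below a fixed
negative number, while `c x * w x` is at least `-|K| * δ`: impossible for small `δ`. -/

/-! ### Reflection across the hyperplane. -/

theorem lastCoord_reflectT {d : ℕ} (l : ℝ) (x : Space d) :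
    lastCoord (reflectT l x) = 2 * l - lastCoord x := by
  simp [lastCoord, reflectT]

theorem reflectT_reflectT {d : ℕ} (l : ℝ) (x : Space d) : reflectT l (reflectT l x) = x := by
  ext i
  simp [reflectT, lastCoord]

theorem abs_lastCoord_sub_le {d : ℕ} (x y : Space d) : |lastCoord x - lastCoord y| ≤ ‖x - y‖ := by
  simpa [lastCoord] using PiLp.norm_apply_le (x - y) (Fin.last d)

theorem continuous_lastCoord {d : ℕ} : Continuous (lastCoord : Space d → ℝ) := by
  unfold lastCoord; fun_prop

/-- Only the last coordinate changes, and `(2l - a - b)² - (a - b)² = 4(l - a)(l - b)`. This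
measures how much the kernel loses under reflection. -/
theorem norm_sub_reflectT_sq {d : ℕ} (l : ℝ) (x y : Space d) :
    ‖x - reflectT l y‖ ^ 2 = ‖x - y‖ ^ 2 + 4 * (l - lastCoord x) * (l - lastCoord y) := by
  simp only [EuclideanSpace.norm_sq_eq, Fin.sum_univ_castSucc, reflectT, lastCoord,
    PiLp.sub_apply, Real.norm_eq_abs, sq_abs, Function.update_self,
    Function.update_of_ne (Fin.castSucc_ne_last _)]
  ring

theorem dist_reflectT_self {d : ℕ} (l : ℝ) {x : Space d} (hx : lastCoord x ≤ l) :
    dist x (reflectT l x) = 2 * (l - lastCoord x) := by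
  have h := norm_sub_reflectT_sq l x x
  rw [dist_eq_norm]
  refine (pow_left_inj₀ (norm_nonneg _) (by linarith) two_ne_zero).1 ?_
  rw [h]; simp; ring

theorem measurePreserving_reflectT (d : ℕ) (l : ℝ) :
    MeasurePreserving (reflectT l : Space d → Space d) := by
  have h : MeasurePreserving (fun (x : Fin (d + 1) → ℝ) i =>
      (if i = Fin.last d then fun t : ℝ => 2 * l - t else id) (x i)) := by
    refine volume_preserving_pi (f := fun i =>
      if i = Fin.last d then fun t : ℝ => 2 * l - t else id) fun i => ?_
    split_ifs
    · exact Measure.measurePreserving_sub_left volume (2 * l)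
    · exact MeasurePreserving.id _
  have := ((PiLp.volume_preserving_toLp (Fin (d + 1))).comp h).comp
    (PiLp.volume_preserving_ofLp (Fin (d + 1)))
  convert this using 1
  ext x i
  by_cases hi : i = Fin.last d
  · subst hi; simp [reflectT, lastCoord]
  · simp [reflectT, lastCoord, hi]

theorem volume_hyperplaneT (d : ℕ) (l : ℝ) : volume (hyperplaneT d l) = 0 := by
  have h := (PiLp.volume_preserving_ofLp (Fin (d + 1))).measure_preimage
    (s := {f : Fin (d + 1) → ℝ | f (Fin.last d) = l})
    (measurableSet_eq_fun (by fun_prop) (by fun_prop)).nullMeasurableSet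
  rw [volume_pi, Measure.pi_hyperplane] at h
  exact h

theorem measurableEmbedding_reflectT (d : ℕ) (l : ℝ) :
    MeasurableEmbedding (reflectT l : Space d → Space d) :=
  (MeasurableEquiv.mk ⟨reflectT l, reflectT l, reflectT_reflectT l, reflectT_reflectT l⟩
    (measurePreserving_reflectT d l).measurable
    (measurePreserving_reflectT d l).measurable).measurableEmbedding

theorem measurableSet_halfSpaceBelow (d : ℕ) (l : ℝ) : MeasurableSet (halfSpaceBelow d l) :=
  (isOpen_lt continuous_lastCoord continuous_const).measurableSet

theorem reflectT_preimage_halfSpaceAbove (d : ℕ) (l : ℝ) :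
    reflectT l ⁻¹' {x : Space d | l < lastCoord x} = halfSpaceBelow d l := by
  ext x
  simp only [mem_preimage, mem_ofPred_eq, lastCoord_reflectT, halfSpaceBelow]
  constructor <;> intro h <;> linarith

theorem compl_halfSpaceBelow_ae_eq (d : ℕ) (l : ℝ) :
    ((halfSpaceBelow d l)ᶜ : Set (Space d)) =ᵐ[volume] {x : Space d | l < lastCoord x} := by
  have h : ∀ᵐ x : Space d, x ∉ hyperplaneT d l := measure_eq_zero_iff_ae_notMem.1
    (volume_hyperplaneT d l)
  refine Filter.eventuallyEq_set.2 (h.mono fun x hx => ?_)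
  simp only [hyperplaneT, mem_ofPred_eq] at hx
  simp only [halfSpaceBelow, mem_compl_iff, mem_ofPred_eq, not_lt]
  exact ⟨fun h => lt_of_le_of_ne h (Ne.symm hx), le_of_lt⟩

theorem setIntegral_compl_halfSpaceBelow (d : ℕ) (l : ℝ) (f : Space d → ℝ) :
    ∫ x in (halfSpaceBelow d l)ᶜ, f x = ∫ x in halfSpaceBelow d l, f (reflectT l x) := by
  rw [setIntegral_congr_set (compl_halfSpaceBelow_ae_eq d l), ← reflectT_preimage_halfSpaceAbove,
    (measurePreserving_reflectT d l).setIntegral_preimage_emb (measurableEmbedding_reflectT d l)]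

theorem integrableOn_comp_reflectT {d : ℕ} {l : ℝ} {f : Space d → ℝ}
    (hf : IntegrableOn f (halfSpaceBelow d l)ᶜ) :
    IntegrableOn (fun x => f (reflectT l x)) (halfSpaceBelow d l) := by
  have h := hf.congr_set_ae (compl_halfSpaceBelow_ae_eq d l).symm
  rw [← (measurePreserving_reflectT d l).integrableOn_comp_preimage
    (measurableEmbedding_reflectT d l), reflectT_preimage_halfSpaceAbove] at h
  exact h

/-! ### Integrability of the kernel and cancellation of odd terms. -/

section Kernel

open Module (finrank)

variable {E : Type*} [NormedAddCommGroup E] [InnerProductSpace ℝ E] [FiniteDimensional ℝ E]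
  [MeasurableSpace E] [BorelSpace E]

/-- In polar coordinates the radial integrand is `t ^ (n + 1 - p)`, whose exponent exceeds `-1`. -/
theorem integrableOn_ball_sq_norm_div_rpow [Nontrivial E] {p : ℝ} (hp : p < finrank ℝ E + 2)
    {r : ℝ} (hr : 0 < r) :
    IntegrableOn (fun z : E => ‖z‖ ^ 2 / ‖z‖ ^ p) (Metric.ball 0 r) := by
  rw [integrableOn_fun_norm_addHaar volume (f := fun t : ℝ => t ^ 2 / t ^ p)]
  have h : IntegrableOn (fun t : ℝ => t ^ ((finrank ℝ E : ℝ) + 1 - p)) (Ioo 0 r) :=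
    (intervalIntegral.integrableOn_Ioo_rpow_iff hr).2 (by linarith)
  refine h.congr_fun (fun t ht => ?_) measurableSet_Ioo
  have h1 : 1 ≤ finrank ℝ E := Module.finrank_pos
  simp only [smul_eq_mul]
  rw [Real.rpow_sub ht.1, mul_div_assoc', ← pow_add, ← Real.rpow_natCast]
  congr 2
  push_cast [h1]
  ring

theorem integrableOn_compl_ball_one_div_norm_rpow {p : ℝ} (hp : (finrank ℝ E : ℝ) < p)
    {r : ℝ} (hr : 0 < r) :
    IntegrableOn (fun z : E => 1 / ‖z‖ ^ p) (Metric.ball 0 r)ᶜ := by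
  have hp0 : 0 ≤ p := le_trans (by positivity) hp.le
  have h := (integrable_one_add_norm (E := E) (μ := volume) hp).const_mul ((1 + 1 / r) ^ p)
  refine Integrable.mono' h.integrableOn ?_ ?_
  · exact (Measurable.div (by fun_prop) (by fun_prop)).aestronglyMeasurable
  · refine ae_restrict_of_forall_mem Metric.isOpen_ball.measurableSet.compl fun z hz => ?_
    have hz : r ≤ ‖z‖ := by simpa using hz
    have hz0 : 0 < ‖z‖ := hr.trans_le hz
    rw [Real.norm_of_nonneg (by positivity), Real.rpow_neg (by positivity), ← div_eq_mul_inv,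
      div_le_div_iff₀ (by positivity) (by positivity), one_mul,
      ← Real.mul_rpow (by positivity) hz0.le]
    -- Off the ball, `1 + ‖z‖ ≤ (1 + 1 / r) * ‖z‖`.
    refine Real.rpow_le_rpow (by positivity) ?_ hp0
    have : 1 ≤ 1 / r * ‖z‖ := by rw [one_div, inv_mul_eq_div, le_div_iff₀ hr]; linarith
    linarith

theorem sub_preimage_ball {E : Type*} [SeminormedAddCommGroup E] (x : E) (r : ℝ) :
    (fun y : E => y - x) ⁻¹' Metric.ball 0 r = Metric.ball x r := by
  ext y; simp [dist_eq_norm]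

theorem integrableOn_preimage_sub_right {f : E → ℝ} {S : Set E} (x : E) (hf : IntegrableOn f S) :
    IntegrableOn (fun y => f (y - x)) ((fun y => y - x) ⁻¹' S) :=
  ((measurePreserving_sub_right volume x).integrableOn_comp_preimage
    (measurableEmbedding_subRight x)).2 hf

theorem setIntegral_preimage_sub_right (f : E → ℝ) (S : Set E) (x : E) :
    ∫ y in (fun y => y - x) ⁻¹' S, f (y - x) = ∫ z in S, f z :=
  (measurePreserving_sub_right volume x).setIntegral_preimage_emb
    (measurableEmbedding_subRight x) f S

theorem setIntegral_annulus_odd {f : E → ℝ} (hf : ∀ z, f (-z) = -f z) (r ε : ℝ) :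
    ∫ z in Metric.ball (0 : E) r \ Metric.ball 0 ε, f z = 0 := by
  have hm : MeasurableSet (Metric.ball (0 : E) r \ Metric.ball 0 ε) := by measurability
  rw [← integral_indicator hm]
  have h := integral_neg_eq_self
    ((Metric.ball (0 : E) r \ Metric.ball 0 ε).indicator f) volume
  have h2 : ∀ z, (Metric.ball (0 : E) r \ Metric.ball 0 ε).indicator f (-z) =
      -(Metric.ball (0 : E) r \ Metric.ball 0 ε).indicator f z := by
    intro z
    by_cases hz : z ∈ Metric.ball (0 : E) r \ Metric.ball 0 ε
    · rw [indicator_of_mem hz, indicator_of_mem (by simpa using hz), hf]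
    · rw [indicator_of_notMem hz, indicator_of_notMem (by simpa using hz), neg_zero]
  simp only [h2, integral_neg] at h
  linarith

theorem integrableOn_annulus_of_continuousOn {f : E → ℝ} (hf : ContinuousOn f {0}ᶜ) (r : ℝ) {ε : ℝ}
    (hε : 0 < ε) : IntegrableOn f (Metric.ball 0 r \ Metric.ball 0 ε) := by
  have hc : IsCompact (Metric.closedBall (0 : E) r \ Metric.ball 0 ε) :=
    (isCompact_closedBall 0 r).diff Metric.isOpen_ball
  refine (ContinuousOn.integrableOn_compact hc (hf.mono ?_)).mono_set
    (sdiff_subset_sdiff_left Metric.ball_subset_closedBall)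
  rintro z ⟨-, hz⟩ rfl
  exact hz (Metric.mem_ball_self hε)

/-- A quadratic upper barrier for the increments of `u` at `x` bounds the truncated singular
integral over an annulus: the linear part cancels. -/
theorem setIntegral_annulus_le_of_quadratic_bound [Nontrivial E] {p : ℝ}
    (hp : p < finrank ℝ E + 2) {u : E → ℝ} {x v : E} {A r ε : ℝ} (hA : 0 ≤ A) (hr : 0 < r)
    (hε : 0 < ε)
    (hint : IntegrableOn (fun y => (u x - u y) / ‖x - y‖ ^ p) (Metric.ball x ε)ᶜ)
    (hu : ∀ y ∈ Metric.ball x r, u x - u y ≤ A * (2 * inner ℝ v (y - x) + ‖y - x‖ ^ 2)) :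
    ∫ y in Metric.ball x r \ Metric.ball x ε, (u x - u y) / ‖x - y‖ ^ p ≤
      A * ∫ z in Metric.ball (0 : E) r, ‖z‖ ^ 2 / ‖z‖ ^ p := by
  set S : Set E := Metric.ball (0 : E) r \ Metric.ball 0 ε
  have hS : Metric.ball x r \ Metric.ball x ε = (fun y : E => y - x) ⁻¹' S := by
    rw [preimage_sdiff, sub_preimage_ball, sub_preimage_ball]
  have hm : MeasurableSet (Metric.ball x r \ Metric.ball x ε) := by measurability
  have hnorm : ContinuousOn (fun z : E => ‖z‖ ^ p) {0}ᶜ :=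
    continuous_norm.continuousOn.rpow_const fun z hz => Or.inl (norm_ne_zero_iff.2 hz)
  have hnorm0 : ∀ z ∈ ({0}ᶜ : Set E), ‖z‖ ^ p ≠ 0 := fun z hz =>
    (Real.rpow_pos_of_pos (norm_pos_iff.2 hz) p).ne'
  have h1 : IntegrableOn (fun z : E => inner ℝ v z / ‖z‖ ^ p) S :=
    integrableOn_annulus_of_continuousOn
      (ContinuousOn.div (by fun_prop) hnorm hnorm0) r hε
  have h2 : IntegrableOn (fun z : E => ‖z‖ ^ 2 / ‖z‖ ^ p) S :=
    (integrableOn_ball_sq_norm_div_rpow hp hr).mono_set sdiff_subset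
  have h3 : IntegrableOn (fun z : E =>
      2 * A * (inner ℝ v z / ‖z‖ ^ p) + A * (‖z‖ ^ 2 / ‖z‖ ^ p)) S :=
    (h1.const_mul _).add (h2.const_mul _)
  calc ∫ y in Metric.ball x r \ Metric.ball x ε, (u x - u y) / ‖x - y‖ ^ p
      ≤ ∫ y in Metric.ball x r \ Metric.ball x ε, (2 * A * (inner ℝ v (y - x) / ‖y - x‖ ^ p) +
          A * (‖y - x‖ ^ 2 / ‖y - x‖ ^ p)) := by
        refine setIntegral_mono_on (hint.mono_set fun y hy => hy.2) ?_ hm fun y hy => ?_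
        · rw [hS]; exact integrableOn_preimage_sub_right x h3
        · rw [norm_sub_rev x y]
          have := div_le_div_of_nonneg_right (hu y hy.1)
            (Real.rpow_nonneg (norm_nonneg (y - x)) p)
          refine this.trans (le_of_eq ?_)
          ring
    _ = ∫ z in S, (2 * A * (inner ℝ v z / ‖z‖ ^ p) + A * (‖z‖ ^ 2 / ‖z‖ ^ p)) := by
        rw [hS]
        exact setIntegral_preimage_sub_right
          (fun z => 2 * A * (inner ℝ v z / ‖z‖ ^ p) + A * (‖z‖ ^ 2 / ‖z‖ ^ p)) S x
    _ = A * ∫ z in S, ‖z‖ ^ 2 / ‖z‖ ^ p := by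
        rw [integral_add (h1.const_mul _) (h2.const_mul _), integral_const_mul,
          integral_const_mul, setIntegral_annulus_odd (fun z => by simp [neg_div]), mul_zero,
          zero_add]
    _ ≤ A * ∫ z in Metric.ball (0 : E) r, ‖z‖ ^ 2 / ‖z‖ ^ p := by
        refine mul_le_mul_of_nonneg_left (setIntegral_mono_set
          (integrableOn_ball_sq_norm_div_rpow hp hr)
          (Eventually.of_forall fun z => ?_) sdiff_subset.eventuallyLE) hA
        simp only [Pi.zero_apply]
        positivity

end Kernel

/-! ### Quantitative gap between the kernel and its reflection. -/

/-- Since `A ≤ M`, the additive gap `t` between the squares is a multiplicative one: `B ≥ A * θ`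
with `θ² = 1 + t / M²`. The difference is then at least `(1 - θ ^ (-p)) / A ^ p`. -/
theorem one_div_rpow_sub_ge {p M t A B : ℝ} (hp : 0 < p) (ht : 0 < t) (hA : 0 < A) (hAM : A ≤ M)
    (hB : 0 ≤ B) (hAB : A ^ 2 + t ≤ B ^ 2) :
    1 / M ^ p * (1 - 1 / √(1 + t / M ^ 2) ^ p) ≤ 1 / A ^ p - 1 / B ^ p := by
  have hM : 0 < M := hA.trans_le hAM
  set θ := √(1 + t / M ^ 2)
  have hθ1 : 1 ≤ θ := Real.one_le_sqrt.2 (by linarith [show 0 < t / M ^ 2 by positivity])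
  have hθ0 : 0 < θ := by linarith
  have hBθ : A * θ ≤ B := by
    refine (pow_le_pow_iff_left₀ (by positivity) hB two_ne_zero).1 (le_trans ?_ hAB)
    rw [mul_pow, Real.sq_sqrt (by positivity), mul_add, mul_one]
    gcongr
    rw [mul_div_assoc', div_le_iff₀ (by positivity), mul_comm]
    gcongr
  have h1 : 1 / B ^ p ≤ 1 / A ^ p * (1 / θ ^ p) := by
    rw [one_div_mul_one_div, ← Real.mul_rpow hA.le hθ0.le]
    exact one_div_le_one_div_of_le (by positivity)
      (Real.rpow_le_rpow (by positivity) hBθ hp.le)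
  have h2 : 1 / M ^ p ≤ 1 / A ^ p :=
    one_div_le_one_div_of_le (by positivity) (Real.rpow_le_rpow hA.le hAM hp.le)
  have h3 : 0 ≤ 1 - 1 / θ ^ p := by
    rw [sub_nonneg, div_le_one (by positivity)]
    exact Real.one_le_rpow hθ1 hp.le
  nlinarith [mul_le_mul_of_nonneg_right h2 h3]

theorem one_div_rpow_gap_pos {p M t : ℝ} (hp : 0 < p) (ht : 0 < t) (hM : 0 < M) :
    0 < 1 / M ^ p * (1 - 1 / √(1 + t / M ^ 2) ^ p) := by
  have hθ1 : 1 < √(1 + t / M ^ 2) := by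
    rw [Real.lt_sqrt (by norm_num)]; linarith [show 0 < t / M ^ 2 by positivity]
  have : 1 < √(1 + t / M ^ 2) ^ p := Real.one_lt_rpow hθ1 hp
  refine mul_pos (by positivity) ?_
  rw [sub_pos, div_lt_one (by positivity)]
  exact this

theorem fracLapConst_pos (d : ℕ) {s : ℝ} (hs0 : 0 < s) (hs1 : s < 1) :
    0 < fracLapConst (d + 1) s := by
  have h : Real.Gamma (-s) ≠ 0 := by
    refine Real.Gamma_ne_zero fun m hm => ?_
    have hm' : s = m := by linarith
    rw [hm'] at hs0 hs1
    have h0 : 0 < m := by exact_mod_cast hs0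
    have h1 : m < 1 := by exact_mod_cast hs1
    omega
  have hG : 0 < Real.Gamma (((d + 1 : ℕ) : ℝ) / 2 + s) := Real.Gamma_pos_of_pos (by positivity)
  have hG' := abs_pos.2 h
  unfold fracLapConst
  positivity

theorem norm_sub_reflectT_ge {d : ℕ} {l m : ℝ} {x y : Space d} (hx : lastCoord x ≤ l - m)
    (hy : lastCoord y ≤ l) : m ≤ ‖x - reflectT l y‖ := by
  have h := (neg_le_abs _).trans (abs_lastCoord_sub_le x (reflectT l y))
  rw [lastCoord_reflectT] at h
  linarith

theorem norm_sub_le_norm_sub_reflectT {d : ℕ} {l : ℝ} {x y : Space d} (hx : lastCoord x ≤ l)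
    (hy : lastCoord y ≤ l) : ‖x - y‖ ≤ ‖x - reflectT l y‖ := by
  refine (pow_le_pow_iff_left₀ (norm_nonneg _) (norm_nonneg _) two_ne_zero).1 ?_
  rw [norm_sub_reflectT_sq]
  nlinarith [mul_nonneg (sub_nonneg.2 hx) (sub_nonneg.2 hy)]

/-! ### Upper bound for the fractional Laplacian at a touching point. -/

/-- The part of the singular integral of an antisymmetric function away from the base point,
folded onto the half space by reflection. -/
theorem setIntegral_compl_ball_eq_of_antisymm {d : ℕ} {l p r : ℝ} {w : Space d → ℝ} {x : Space d}
    (hball : Metric.ball x r ⊆ halfSpaceBelow d l)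
    (hint : IntegrableOn (fun y => (w x - w y) / ‖x - y‖ ^ p) (Metric.ball x r)ᶜ)
    (hanti : ∀ y ∈ halfSpaceBelow d l, w y = -w (reflectT l y)) :
    IntegrableOn (fun y => (w x + w y) / ‖x - reflectT l y‖ ^ p) (halfSpaceBelow d l) ∧
    ∫ y in (Metric.ball x r)ᶜ, (w x - w y) / ‖x - y‖ ^ p =
      (∫ y in halfSpaceBelow d l \ Metric.ball x r,
        ((w x - w y) / ‖x - y‖ ^ p + (w x + w y) / ‖x - reflectT l y‖ ^ p)) +
      ∫ y in Metric.ball x r, (w x + w y) / ‖x - reflectT l y‖ ^ p := by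
  set S := halfSpaceBelow d l
  set F : Space d → ℝ := fun y => (w x - w y) / ‖x - y‖ ^ p
  have hmS : MeasurableSet S := measurableSet_halfSpaceBelow d l
  have hmB : MeasurableSet (Metric.ball x r) := measurableSet_ball
  have hsub : Sᶜ ⊆ (Metric.ball x r)ᶜ := compl_subset_compl.2 hball
  have hF : ∀ y ∈ S, F (reflectT l y) = (w x + w y) / ‖x - reflectT l y‖ ^ p := by
    intro y hy
    simp only [F, hanti y hy, sub_eq_add_neg]
  have hi : IntegrableOn (fun y => (w x + w y) / ‖x - reflectT l y‖ ^ p) S :=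
    (integrableOn_comp_reflectT (hint.mono_set hsub)).congr_fun hF hmS
  refine ⟨hi, ?_⟩
  have hunion : (Metric.ball x r)ᶜ = (S \ Metric.ball x r) ∪ Sᶜ := by
    ext y
    by_cases hy : y ∈ S
    · simp [hy]
    · simp [hy, show y ∉ Metric.ball x r from fun h => hy (hball h)]
  have h1 : ∫ y in (Metric.ball x r)ᶜ, F y =
      (∫ y in S \ Metric.ball x r, F y) + ∫ y in Sᶜ, F y := by
    conv_lhs => rw [hunion]
    refine setIntegral_union (disjoint_compl_right.mono_left sdiff_subset) hmS.compl
      (hint.mono_set fun y hy => hy.2) (hint.mono_set hsub)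
  have h2 : ∫ y in S, (w x + w y) / ‖x - reflectT l y‖ ^ p =
      (∫ y in S \ Metric.ball x r, (w x + w y) / ‖x - reflectT l y‖ ^ p) +
      ∫ y in Metric.ball x r, (w x + w y) / ‖x - reflectT l y‖ ^ p := by
    rw [← setIntegral_union disjoint_sdiff_left hmB (hi.mono_set sdiff_subset)
      (hi.mono_set hball), sdiff_union_of_subset hball]
  rw [h1, setIntegral_compl_halfSpaceBelow, setIntegral_congr_fun hmS hF, h2, ← add_assoc,
    ← integral_add (hint.mono_set fun y hy => hy.2) (hi.mono_set sdiff_subset)]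

/-- A function that is antisymmetric, nonnegative on the half space and small at `x` gains a
negative contribution to its singular integral from every set `G` where it is large. -/
theorem setIntegral_compl_ball_le_of_antisymm {d : ℕ} {l p r m δ b C κ : ℝ} {w : Space d → ℝ}
    {x : Space d} {G : Set (Space d)} (hp : ((d + 1 : ℕ) : ℝ) < p) (hr : 0 < r) (hm : 0 < m)
    (hxm : lastCoord x ≤ l - m)
    (hball : Metric.ball x r ⊆ halfSpaceBelow d l)
    (hint : IntegrableOn (fun y => (w x - w y) / ‖x - y‖ ^ p) (Metric.ball x r)ᶜ)
    (hanti : ∀ y ∈ halfSpaceBelow d l, w y = -w (reflectT l y))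
    (hnonneg : ∀ y ∈ halfSpaceBelow d l, 0 ≤ w y)
    (hxδ : w x ≤ δ) (hb : ∀ y ∈ Metric.ball x r, w y ≤ b)
    (hGm : MeasurableSet G) (hGfin : volume G ≠ ⊤)
    (hG : G ⊆ halfSpaceBelow d l \ Metric.ball x r) (hC : 0 ≤ C) (hGC : ∀ y ∈ G, C ≤ w y)
    (hGκ : ∀ y ∈ G, κ ≤ 1 / ‖x - y‖ ^ p - 1 / ‖x - reflectT l y‖ ^ p) :
    ∫ y in (Metric.ball x r)ᶜ, (w x - w y) / ‖x - y‖ ^ p ≤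
      2 * δ * (∫ z in (Metric.ball (0 : Space d) r)ᶜ, 1 / ‖z‖ ^ p) - C * κ * volume.real G +
      (δ + b) * (1 / m ^ p) * volume.real (Metric.ball x r) := by
  obtain ⟨hi, heq⟩ := setIntegral_compl_ball_eq_of_antisymm hball hint hanti
  have hp0 : 0 ≤ p := le_trans (by positivity) hp.le
  have hxS : x ∈ halfSpaceBelow d l := hball (Metric.mem_ball_self hr)
  have hwx : 0 ≤ w x := hnonneg x hxS
  have hmS := measurableSet_halfSpaceBelow d l
  have hmB : MeasurableSet (Metric.ball x r) := measurableSet_ball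
  have hk0 : IntegrableOn (fun z : Space d => 1 / ‖z‖ ^ p) (Metric.ball 0 r)ᶜ :=
    integrableOn_compl_ball_one_div_norm_rpow (by simpa using hp) hr
  have hpre : (fun y : Space d => y - x) ⁻¹' (Metric.ball 0 r)ᶜ = (Metric.ball x r)ᶜ := by
    rw [preimage_compl, sub_preimage_ball]
  have hk : IntegrableOn (fun y : Space d => 1 / ‖y - x‖ ^ p) (Metric.ball x r)ᶜ := by
    rw [← hpre]; exact integrableOn_preimage_sub_right x hk0
  have hkeq : ∫ y in (Metric.ball x r)ᶜ, 1 / ‖y - x‖ ^ p =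
      ∫ z in (Metric.ball (0 : Space d) r)ᶜ, 1 / ‖z‖ ^ p := by
    rw [← hpre]; exact setIntegral_preimage_sub_right (fun z => 1 / ‖z‖ ^ p) _ x
  have hδ : 0 ≤ δ := hwx.trans hxδ
  have hGi : IntegrableOn (G.indicator fun _ => C * κ) (halfSpaceBelow d l \ Metric.ball x r) :=
    ((integrable_indicator_iff hGm).2 (integrableOn_const hGfin)).integrableOn
  have hki : IntegrableOn (fun y : Space d => 2 * δ * (1 / ‖y - x‖ ^ p))
      (halfSpaceBelow d l \ Metric.ball x r) :=
    IntegrableOn.mono_set (hk.const_mul _) fun y hy => hy.2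
  have hfar : ∫ y in halfSpaceBelow d l \ Metric.ball x r,
        ((w x - w y) / ‖x - y‖ ^ p + (w x + w y) / ‖x - reflectT l y‖ ^ p) ≤
      2 * δ * (∫ z in (Metric.ball (0 : Space d) r)ᶜ, 1 / ‖z‖ ^ p) -
        C * κ * volume.real G := by
    calc _ ≤ ∫ y in halfSpaceBelow d l \ Metric.ball x r,
          (2 * δ * (1 / ‖y - x‖ ^ p) - G.indicator (fun _ => C * κ) y) := by
          refine setIntegral_mono_on ((hint.mono_set fun y hy => hy.2).add
            (hi.mono_set sdiff_subset)) (hki.sub hGi) (hmS.diff hmB) fun y hy => ?_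
          have hyS : lastCoord y < l := hy.1
          have hne : 0 < ‖x - y‖ := hr.trans_le (by
            have := hy.2
            rwa [Metric.mem_ball, not_lt, dist_comm, dist_eq_norm] at this)
          have hle := norm_sub_le_norm_sub_reflectT (le_of_lt (show lastCoord x < l from hxS))
            hyS.le
          have hkk : 1 / ‖x - reflectT l y‖ ^ p ≤ 1 / ‖x - y‖ ^ p :=
            one_div_le_one_div_of_le (by positivity) (Real.rpow_le_rpow hne.le hle hp0)
          have hk1 : 0 ≤ 1 / ‖x - y‖ ^ p := by positivity
          have hwy := hnonneg y hy.1
          have hind : G.indicator (fun _ => C * κ) y ≤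
              w y * (1 / ‖x - y‖ ^ p - 1 / ‖x - reflectT l y‖ ^ p) := by
            by_cases hyG : y ∈ G
            · rw [indicator_of_mem hyG]
              exact (mul_le_mul_of_nonneg_left (hGκ y hyG) hC).trans
                (mul_le_mul_of_nonneg_right (hGC y hyG) (sub_nonneg.2 hkk))
            · rw [indicator_of_notMem hyG]
              exact mul_nonneg hwy (sub_nonneg.2 hkk)
          -- With `k ≥ k'` the two kernels, the integrand is `w x * (k + k') - w y * (k - k')`, at
          -- most `2 * δ * k - w y * (k - k')`.
          rw [norm_sub_rev y x, div_eq_mul_one_div (w x - w y), div_eq_mul_one_div (w x + w y)]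
          nlinarith [mul_le_mul_of_nonneg_left hkk hwx, mul_le_mul_of_nonneg_right hxδ hk1]
      _ = (∫ y in halfSpaceBelow d l \ Metric.ball x r, 2 * δ * (1 / ‖y - x‖ ^ p)) -
          C * κ * volume.real G := by
          rw [integral_sub hki hGi, setIntegral_indicator hGm, inter_eq_self_of_subset_right hG,
            setIntegral_const, smul_eq_mul, mul_comm (volume.real G)]
      _ ≤ _ := by
          rw [integral_const_mul, ← hkeq]
          have hsubB : halfSpaceBelow d l \ Metric.ball x r ⊆ (Metric.ball x r)ᶜ :=
            fun y hy => hy.2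
          gcongr
          refine Eventually.of_forall fun z => ?_
          simp only [Pi.zero_apply]
          positivity
  have hnear : ∫ y in Metric.ball x r, (w x + w y) / ‖x - reflectT l y‖ ^ p ≤
      (δ + b) * (1 / m ^ p) * volume.real (Metric.ball x r) := by
    calc _ ≤ ∫ y in Metric.ball x r, (δ + b) * (1 / m ^ p) := by
          refine setIntegral_mono_on (hi.mono_set hball)
            (integrableOn_const measure_ball_lt_top.ne) hmB fun y hy => ?_
          have hyS : lastCoord y < l := hball hy
          rw [div_eq_mul_one_div (w x + w y)]
          have hwy := hnonneg y (hball hy)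
          refine mul_le_mul (by linarith [hb y hy]) ?_ (by positivity) (by linarith [hb y hy])
          exact one_div_le_one_div_of_le (by positivity)
            (Real.rpow_le_rpow hm.le (norm_sub_reflectT_ge hxm hyS.le) hp0)
      _ = _ := by rw [setIntegral_const, smul_eq_mul, mul_comm]
  rw [heq]
  linarith

/-- Touching a function from below by a concave paraboloid: if `w` is small at `x₀` and
nonnegative on `S`, then near `x₀` there is a point where the decrements of `w` on `S` have a
quadratic upper bound. -/
theorem exists_quadratic_touching_point {E : Type*} [NormedAddCommGroup E] [InnerProductSpace ℝ E]
    [FiniteDimensional ℝ E] {w : E → ℝ} (hw : Continuous w) {S : Set E} {x₀ : E} {ρ δ : ℝ}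
    (hρ : 0 < ρ) (hδ : 0 < δ) (hx₀ : w x₀ < δ) (hnonneg : ∀ y ∈ S, 0 ≤ w y) :
    ∃ x ∈ Metric.closedBall x₀ ρ, w x < δ ∧ ∀ y ∈ S,
      w x - w y ≤ δ / ρ ^ 2 * (2 * inner ℝ (x - x₀) (y - x) + ‖y - x‖ ^ 2) := by
  obtain ⟨x, hx, hmin⟩ := (isCompact_closedBall x₀ ρ).exists_isMinOn
    ⟨x₀, Metric.mem_closedBall_self hρ.le⟩
    (f := fun y => w y + δ / ρ ^ 2 * ‖y - x₀‖ ^ 2) (by fun_prop)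
  have h0 : w x + δ / ρ ^ 2 * ‖x - x₀‖ ^ 2 ≤ w x₀ := by
    simpa using hmin (Metric.mem_closedBall_self hρ.le)
  have hA : 0 < δ / ρ ^ 2 := by positivity
  refine ⟨x, hx, by nlinarith [mul_nonneg hA.le (sq_nonneg ‖x - x₀‖)], fun y hy => ?_⟩
  have hle : w x + δ / ρ ^ 2 * ‖x - x₀‖ ^ 2 ≤ w y + δ / ρ ^ 2 * ‖y - x₀‖ ^ 2 := by
    by_cases hyB : y ∈ Metric.closedBall x₀ ρ
    · exact hmin hyB
    -- Outside the ball the penalty alone is at least `δ > w x₀`, so the minimum over the ball is a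
    -- minimum over `S` too.
    · rw [Metric.mem_closedBall, not_le, dist_eq_norm] at hyB
      have h1 : δ ≤ δ / ρ ^ 2 * ‖y - x₀‖ ^ 2 := by
        rw [div_mul_eq_mul_div, le_div_iff₀ (by positivity)]
        gcongr
      linarith [hnonneg y hy]
  have hexp : ‖y - x₀‖ ^ 2 = ‖x - x₀‖ ^ 2 + 2 * inner ℝ (x - x₀) (y - x) + ‖y - x‖ ^ 2 := by
    rw [← norm_add_sq_real]; congr 2; abel
  rw [hexp] at hle
  linarith

theorem HasFracLaplacian.le_of_truncated_le {d : ℕ} {s r U v : ℝ} {w : Space d → ℝ} {x : Space d}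
    (hs0 : 0 < s) (hs1 : s < 1) (hr : 0 < r) (h : HasFracLaplacian s w x v)
    (hU : ∀ ε ∈ Ioo 0 r,
      ∫ y in (Metric.ball x ε)ᶜ, (w x - w y) / ‖x - y‖ ^ (((d + 1 : ℕ) : ℝ) + 2 * s) ≤ U) :
    v ≤ fracLapConst (d + 1) s * U := by
  refine le_of_tendsto h.2 ?_
  filter_upwards [Ioo_mem_nhdsGT hr] with ε hε
  exact mul_le_mul_of_nonneg_left (hU ε hε) (fracLapConst_pos d hs0 hs1).le

/-- The upper bound for the fractional Laplacian of an antisymmetric function at a point where it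
is small and touched from below by a paraboloid. -/
theorem HasFracLaplacian.le_of_antisymm {d : ℕ} {s l r m δ b C κ A v : ℝ} {w : Space d → ℝ}
    {x q : Space d} {G : Set (Space d)} (hs0 : 0 < s) (hs1 : s < 1) (hr : 0 < r) (hm : 0 < m)
    (hA : 0 ≤ A) (h : HasFracLaplacian s w x v) (hxm : lastCoord x ≤ l - m)
    (hball : Metric.ball x r ⊆ halfSpaceBelow d l)
    (hanti : ∀ y ∈ halfSpaceBelow d l, w y = -w (reflectT l y))
    (hnonneg : ∀ y ∈ halfSpaceBelow d l, 0 ≤ w y)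
    (hxδ : w x ≤ δ) (hb : ∀ y ∈ Metric.ball x r, w y ≤ b)
    (hquad : ∀ y ∈ halfSpaceBelow d l,
      w x - w y ≤ A * (2 * inner ℝ q (y - x) + ‖y - x‖ ^ 2))
    (hGm : MeasurableSet G) (hGfin : volume G ≠ ⊤)
    (hG : G ⊆ halfSpaceBelow d l \ Metric.ball x r) (hC : 0 ≤ C) (hGC : ∀ y ∈ G, C ≤ w y)
    (hGκ : ∀ y ∈ G, κ ≤ 1 / ‖x - y‖ ^ (((d + 1 : ℕ) : ℝ) + 2 * s) -
      1 / ‖x - reflectT l y‖ ^ (((d + 1 : ℕ) : ℝ) + 2 * s)) :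
    v ≤ fracLapConst (d + 1) s *
      (A * (∫ z in Metric.ball (0 : Space d) r,
          ‖z‖ ^ 2 / ‖z‖ ^ (((d + 1 : ℕ) : ℝ) + 2 * s)) +
        (2 * δ * (∫ z in (Metric.ball (0 : Space d) r)ᶜ,
            1 / ‖z‖ ^ (((d + 1 : ℕ) : ℝ) + 2 * s)) - C * κ * volume.real G +
          (δ + b) * (1 / m ^ (((d + 1 : ℕ) : ℝ) + 2 * s)) *
            volume.real (Metric.ball x r))) := by
  refine h.le_of_truncated_le hs0 hs1 hr fun ε hε => ?_
  have hsub : Metric.ball x ε ⊆ Metric.ball x r := Metric.ball_subset_ball hε.2.le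
  have hsplit : (Metric.ball x ε)ᶜ = (Metric.ball x r \ Metric.ball x ε) ∪ (Metric.ball x r)ᶜ := by
    ext y
    by_cases hy : y ∈ Metric.ball x r
    · simp [hy]
    · simp [hy, show y ∉ Metric.ball x ε from fun h => hy (hsub h)]
  have hint := h.1 ε hε.1
  rw [hsplit, setIntegral_union (disjoint_compl_right.mono_left sdiff_subset)
    measurableSet_ball.compl (hint.mono_set fun y hy => hy.2)
    (hint.mono_set (compl_subset_compl.2 hsub))]
  refine add_le_add ?_ ?_
  · refine setIntegral_annulus_le_of_quadratic_bound (v := q) ?_ hA hr hε.1 hint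
      fun y hy => hquad y (hball hy)
    rw [finrank_euclideanSpace_fin]
    linarith
  · exact setIntegral_compl_ball_le_of_antisymm (by linarith) hr hm hxm hball (h.1 r hr) hanti
      hnonneg hxδ hb hGm hGfin hG hC hGC hGκ

/-! ### Distance to the hyperplane and the final contradiction. -/

/-- Between `a` and its reflection `w` jumps by `2 * w a ≥ 2 * C`, so these points are at least `η
(2 * C)` apart. -/
theorem half_modulus_le_of_antisymm {d : ℕ} {l C : ℝ} {η : ℝ → ℝ} {w : Space d → ℝ} {a : Space d}
    (hC : 0 < C) (hw : HasModulus η w)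
    (hanti : ∀ y ∈ halfSpaceBelow d l, w y = -w (reflectT l y))
    (ha : a ∈ halfSpaceBelow d l) (hCa : C ≤ w a) :
    η (2 * C) / 2 ≤ l - lastCoord a := by
  by_contra! hlt
  have h1 := hw (2 * C) (by positivity) a (reflectT l a) (by
    rw [dist_reflectT_self l (le_of_lt (show lastCoord a < l from ha))]; linarith)
  have h2 := (abs_lt.1 h1).2
  linarith [hanti a ha]

theorem le_setDist_hyperplaneT {d : ℕ} {l m : ℝ} {D : Set (Space d)} (hD : D.Nonempty)
    (h : ∀ a ∈ D, m ≤ l - lastCoord a) : m ≤ setDist D (hyperplaneT d l) := by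
  obtain ⟨a, ha⟩ := hD
  have ht : EuclideanSpace.single (Fin.last d) l ∈ hyperplaneT d l := by
    simp [hyperplaneT, lastCoord]
  refine le_csInf ⟨_, a, ha, _, ht, rfl⟩ ?_
  rintro _ ⟨a, ha, t, ht, rfl⟩
  have h1 := (neg_le_abs _).trans (abs_lastCoord_sub_le a t)
  rw [dist_eq_norm]
  have ht' : lastCoord t = l := ht
  linarith [h a ha]

theorem volume_real_ball_le_mul {d : ℕ} (x : Space d) {r : ℝ} (hr0 : 0 ≤ r) (hr1 : r ≤ 1) :
    volume.real (Metric.ball x r) ≤ r * volume.real (Metric.ball (0 : Space d) 1) := by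
  rw [Measure.real, Measure.addHaar_ball _ _ hr0, finrank_euclideanSpace_fin, ENNReal.toReal_mul,
    ENNReal.toReal_ofReal (by positivity)]
  exact mul_le_mul_of_nonneg_right (pow_le_of_le_one hr0 hr1 (by simp)) measureReal_nonneg

theorem theorem1p6 (d : ℕ) (s : ℝ) (hs0 : 0 < s) (hs1 : s < 1)
    (R : ℝ) (hR : 0 < R) (C₀ : ℝ) (hC₀ : 0 < C₀)
    (η : ℝ → ℝ) (hη : ∀ ε : ℝ, 0 < ε → 0 < η ε) (K : ℝ) :
    ∃ δ₀ : ℝ, 0 < δ₀ ∧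
      ∀ (l : ℝ) (w c : Space d → ℝ) (D : Set (Space d)),
        IsC11Loc w → MemL2s s w → HasModulus η w →
        (∀ x ∈ halfSpaceBelow d l, HasFracLaplacian s w x (c x * w x)) →
        (∀ x ∈ halfSpaceBelow d l, w x = -w (reflectT l x)) →
        (∀ x ∈ halfSpaceBelow d l, 0 ≤ w x) →
        (∀ x ∈ halfSpaceBelow d l, -K ≤ c x) →
        IsOpen D → IsConnected D → Bornology.IsBounded D → D ⊆ halfSpaceBelow d l →
        (∀ x ∈ D, C₀ ≤ w x) →
        ∀ x ∈ enlargement l R D, δ₀ ≤ w x := by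
  set p : ℝ := ((d + 1 : ℕ) : ℝ) + 2 * s with hp
  have hp0 : 0 < p := by positivity
  -- The depths below the hyperplane will be `4m` for `D`, `2m` for `x₀` and for the ball `G`, and
  -- `m` for the touching point.
  obtain ⟨m, hm, hmη⟩ : ∃ m : ℝ, 0 < m ∧ 8 * m = η (2 * C₀) :=
    ⟨η (2 * C₀) / 8, by have := hη (2 * C₀) (by positivity); positivity, by ring⟩
  obtain ⟨r, hr, hrη, hrm⟩ : ∃ r : ℝ, 0 < r ∧ r ≤ η (C₀ / 2) ∧ r ≤ 2 * m :=
    ⟨min (η (C₀ / 2)) (2 * m), lt_min (hη _ (by positivity)) (by positivity),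
      min_le_left _ _, min_le_right _ _⟩
  set M : ℝ := R + 1 + 4 * m
  set κ : ℝ := 1 / M ^ p * (1 - 1 / √(1 + 8 * m ^ 2 / M ^ 2) ^ p)
  have hκ : 0 < κ := one_div_rpow_gap_pos hp0 (by positivity) (by positivity)
  set g : ℝ := C₀ / 2 * κ * volume.real (Metric.ball (0 : Space d) r)
  have hg : 0 < g := mul_pos (by positivity)
    (ENNReal.toReal_pos (Metric.measure_ball_pos _ _ hr).ne' measure_ball_lt_top.ne)
  set Q : ℝ := 3 * (1 / m ^ p) * volume.real (Metric.ball (0 : Space d) 1)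
  have hQ : 0 ≤ Q := by positivity
  -- The reflected kernel on the ball around `x` leaves an error not small in `δ`, as `w` is only
  -- bounded by `2` there; a small `r₁` absorbs it into `g / 4`. `r₁` is fixed before `δ` because
  -- `I₂` depends on it.
  obtain ⟨r₁, hr₁, hr₁1, hr₁m, hr₁η, hr₁η', hr₁Q⟩ : ∃ r₁ : ℝ, 0 < r₁ ∧ r₁ ≤ 1 ∧ r₁ ≤ m ∧
      r₁ ≤ η 1 ∧ r₁ ≤ η (C₀ / 4) ∧ Q * r₁ ≤ g / 4 := by
    have h1 := hη 1 one_pos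
    have h2 := hη (C₀ / 4) (by positivity)
    have h3 : 0 < g / 4 / (Q + 1) := by positivity
    refine ⟨min (min 1 m) (min (min (η 1) (η (C₀ / 4))) (g / 4 / (Q + 1))), by positivity,
      (min_le_left _ _).trans (min_le_left _ _), (min_le_left _ _).trans (min_le_right _ _),
      ((min_le_right _ _).trans (min_le_left _ _)).trans (min_le_left _ _),
      ((min_le_right _ _).trans (min_le_left _ _)).trans (min_le_right _ _), ?_⟩
    calc _ ≤ Q * (g / 4 / (Q + 1)) :=
          mul_le_mul_of_nonneg_left ((min_le_right _ _).trans (min_le_right _ _)) hQ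
      _ ≤ (Q + 1) * (g / 4 / (Q + 1)) := mul_le_mul_of_nonneg_right (by linarith) h3.le
      _ = g / 4 := mul_div_cancel₀ _ (by positivity)
  set I₁ : ℝ := ∫ z in Metric.ball (0 : Space d) r₁, ‖z‖ ^ 2 / ‖z‖ ^ p
  set I₂ : ℝ := ∫ z in (Metric.ball (0 : Space d) r₁)ᶜ, 1 / ‖z‖ ^ p
  have hI₁ : 0 ≤ I₁ := integral_nonneg fun z => by positivity
  have hI₂ : 0 ≤ I₂ := integral_nonneg fun z => by positivity
  set L : ℝ := fracLapConst (d + 1) s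
  have hL : 0 < L := fracLapConst_pos d hs0 hs1
  set P : ℝ := I₁ / m ^ 2 + 2 * I₂
  have hP : 0 ≤ P := by positivity
  -- The last condition makes all terms linear in `δ` lose to the gain `3 / 4 * (L * g)`.
  obtain ⟨δ, hδ, hδ1, hδC, hδg⟩ : ∃ δ : ℝ, 0 < δ ∧ δ ≤ 1 ∧ δ ≤ C₀ / 4 ∧
      δ * (L * P + |K| + 1) ≤ L * g / 2 := by
    have h1 : 0 < L * P + |K| + 1 := by positivity
    refine ⟨min (min 1 (C₀ / 4)) (L * g / 2 / (L * P + |K| + 1)), by positivity,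
      (min_le_left _ _).trans (min_le_left _ _), (min_le_left _ _).trans (min_le_right _ _), ?_⟩
    rw [← le_div_iff₀ h1]
    exact min_le_right _ _
  refine ⟨δ, hδ, ?_⟩
  intro l w c D hw _ hwη hfrac hanti hnonneg hc _ hDc _ hDS hDC x₀ ⟨_, hx₀R, hx₀l⟩
  by_contra! hx₀
  have hDl : ∀ a ∈ D, 4 * m ≤ l - lastCoord a := fun a ha => by
    have := half_modulus_le_of_antisymm hC₀ hwη hanti (hDS ha) (hDC a ha)
    linarith
  have hx₀l' : lastCoord x₀ ≤ l - 2 * m := by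
    have := le_setDist_hyperplaneT hDc.nonempty hDl
    linarith
  obtain ⟨a, ha, hax⟩ := (Metric.infDist_lt_iff hDc.nonempty).1
    (show Metric.infDist x₀ D < R + 1 by linarith)
  obtain ⟨x, hx, hxδ, hquad⟩ := exists_quadratic_touching_point hw.1.continuous hm hδ hx₀ hnonneg
  rw [Metric.mem_closedBall] at hx
  have hcoord : ∀ y z : Space d, |lastCoord y - lastCoord z| ≤ dist y z := fun y z => by
    rw [dist_eq_norm]; exact abs_lastCoord_sub_le y z
  have hxm : lastCoord x ≤ l - m := by
    linarith [(le_abs_self _).trans (hcoord x x₀)]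
  have hball : Metric.ball x r₁ ⊆ halfSpaceBelow d l := fun y hy => by
    have hy' : dist y x < r₁ := hy
    have := (le_abs_self _).trans (hcoord y x)
    show lastCoord y < l
    linarith
  have hxS : x ∈ halfSpaceBelow d l := hball (Metric.mem_ball_self hr₁)
  have hGl : ∀ y ∈ Metric.ball a r, lastCoord y ≤ l - 2 * m := fun y hy => by
    have hy' : dist y a < r := hy
    linarith [(le_abs_self _).trans (hcoord y a), hDl a ha]
  have hGC : ∀ y ∈ Metric.ball a r, C₀ / 2 ≤ w y := fun y hy => by
    have hy' : dist y a < r := hy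
    have := (abs_lt.1 (hwη (C₀ / 2) (by positivity) y a (by linarith))).1
    linarith [hDC a ha]
  -- The two balls are separated by the values of `w`: below `δ + C₀ / 4 ≤ C₀ / 2` near `x`, at
  -- least `C₀ / 2` on `G`.
  have hGsub : Metric.ball a r ⊆ halfSpaceBelow d l \ Metric.ball x r₁ := fun y hy => by
    refine ⟨show lastCoord y < l by linarith [hGl y hy], fun hyx => ?_⟩
    have hyx' : dist y x < r₁ := hyx
    have := (abs_lt.1 (hwη (C₀ / 4) (by positivity) y x (by linarith))).2
    linarith [hGC y hy]
  have hb : ∀ y ∈ Metric.ball x r₁, w y ≤ 2 := fun y hy => by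
    have hy' : dist y x < r₁ := hy
    have := (abs_lt.1 (hwη 1 one_pos y x (by linarith))).2
    linarith
  have hGκ : ∀ y ∈ Metric.ball a r, κ ≤ 1 / ‖x - y‖ ^ p - 1 / ‖x - reflectT l y‖ ^ p := by
    intro y hy
    have hy' : dist y a < r := hy
    have hne : 0 < ‖x - y‖ := by
      rw [← dist_eq_norm, dist_comm]
      exact hr₁.trans_le (not_lt.1 (hGsub hy).2)
    refine one_div_rpow_sub_ge hp0 (by positivity) hne ?_ (norm_nonneg _) ?_
    · rw [← dist_eq_norm]
      linarith [dist_triangle4 x x₀ a y, dist_comm y a]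
    -- The depths `m` of `x` and `2m` of `y` give the gap `4 * m * 2m = 8 * m ^ 2`.
    · rw [norm_sub_reflectT_sq]
      nlinarith [hGl y hy, mul_nonneg (show 0 ≤ l - lastCoord x - m by linarith)
        (show 0 ≤ l - lastCoord y - 2 * m by linarith [hGl y hy])]
  have hmain := (hfrac x hxS).le_of_antisymm (A := δ / m ^ 2) hs0 hs1 hr₁ hm (by positivity) hxm
    hball hanti hnonneg hxδ.le hb hquad measurableSet_ball measure_ball_lt_top.ne hGsub
    (by positivity) hGC hGκ
  have hvol : volume.real (Metric.ball a r) = volume.real (Metric.ball (0 : Space d) r) := by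
    rw [Measure.real, Measure.real, Measure.addHaar_ball_center]
  have hsmall : (δ + 2) * (1 / m ^ p) * volume.real (Metric.ball x r₁) ≤ g / 4 := by
    calc _ ≤ 3 * (1 / m ^ p) * (r₁ * volume.real (Metric.ball (0 : Space d) 1)) :=
          mul_le_mul (mul_le_mul_of_nonneg_right (by linarith) (by positivity))
            (volume_real_ball_le_mul x hr₁.le hr₁1) measureReal_nonneg (by positivity)
      _ = Q * r₁ := by ring
      _ ≤ g / 4 := hr₁Q
  rw [hvol, ← hp] at hmain
  change c x * w x ≤ L * (δ / m ^ 2 * I₁ + (2 * δ * I₂ - g +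
    (δ + 2) * (1 / m ^ p) * volume.real (Metric.ball x r₁))) at hmain
  have hmain' : c x * w x ≤ L * (δ * P - g + g / 4) := by
    refine hmain.trans (mul_le_mul_of_nonneg_left ?_ hL.le)
    have : δ / m ^ 2 * I₁ + 2 * δ * I₂ = δ * P := by simp only [P]; ring
    linarith
  have hlow : -(|K| * δ) ≤ c x * w x := by
    have h1 : -|K| ≤ c x := (neg_le_neg (le_abs_self K)).trans (hc x hxS)
    have h2 := mul_le_mul_of_nonneg_right h1 (hnonneg x hxS)
    linarith [mul_le_mul_of_nonneg_left hxδ.le (abs_nonneg K)]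
  have hLg := mul_pos hL hg
  have h1 : L * (δ * P - g + g / 4) = δ * (L * P + |K| + 1) - |K| * δ - δ - 3 / 4 * (L * g) := by
    ring
  linarith
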